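/- Let $K$ be a field of characteristic zero. A formal power series $f\in K[[x]]$ is called \emph{invertible} if it has zero constant term and there is $h\in K[[x]]$ with zero constant term such that $f\circ h=h\circ f=\mathrm{id}$, where $\mathrm{id}(x)=x$; an invertible $f$ is called \emph{involutory} if $f\circ f=\mathrm{id}$. Write $f_n=D^n(f)(0)$ for the Taylor coefficients of $f$, where $D$ is the formal derivative, so that $f=\sum_{n\ge 0} f_n x^n/n!$. Let $B_{n,k}\in K[X_1,X_2,\ldots]$ be the partial (exponential) Bell polynomials, $\frac1{k!}\bigl(\sum_{m\ge1}X_m\frac{t^m}{m!}\bigr)^k=\sum_{n\ge k}B_{n,k}\frac{t^n}{n!}$, and let $A_{n,k}\in K[X_1^{\pm1},X_2,X_3,\ldots]$ $(1\le k\le n)$ be the family uniquely determined by $\sum_{j=k}^{n}A_{n,j}B_{j,k}=\delta_{n,k}$ for $1\le k\le n$. The multivariable Lah polynomials are $$L_{n,k}=\sum_{j=k}^{n}(-1)^jA_{n,j}B_{j,k}\qquad(1\le k\le n).$$ \textbf{Theorem.} For every $n\ge1$, $L_{n,1}$ involves only the variables $X_1,\ldots,X_{2[n/2]}$ (polynomially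 in $X_1^{\pm1},X_2,\ldots,X_{2[n/2]}$; it is a constant for $n=1$). Let $f\in K[[x]]$ be invertible with $f\ne\mathrm{id}$. Then $f$ is involutory if and only if there exist constants $g_1,g_2,g_3,\ldots\in K$ with $g_1\neq0$ such that for every $n\ge1$ $$f_n=L_{n,1}(g_1,g_2,\ldots,g_{2[n/2]}).$$ -/

import Mathlib

noncomputable section

namespace InvolutorySeries

/-- Composition `f ∘ g` of formal power series. It is only used for `g` with zero constant
coefficient, where it is the genuine substitution of `g` into `f`. -/
def comp {K : Type*} [Field K] (f g : PowerSeries K) : PowerSeries K :=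
  PowerSeries.subst g f

/-- Compositional invertibility: `f` has a two-sided inverse `h` with respect to composition
(both with zero constant coefficient, so that both compositions make sense). -/
def IsInvertible {K : Type*} [Field K] (f : PowerSeries K) : Prop :=
  PowerSeries.constantCoeff f = 0 ∧
    ∃ h : PowerSeries K, PowerSeries.constantCoeff h = 0 ∧
      comp f h = PowerSeries.X ∧ comp h f = PowerSeries.X

/-- Involutory functions: invertible `f` with `f ∘ f = id`. -/
def IsInvolutory {K : Type*} [Field K] (f : PowerSeries K) : Prop :=
  IsInvertible f ∧ comp f f = PowerSeries.X

/-- The Taylor coefficient `f_n = D^n(f)(0)`, with `D` the formal derivative. -/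
def taylorCoeff {K : Type*} [Field K] (f : PowerSeries K) (n : ℕ) : K :=
  PowerSeries.constantCoeff ((PowerSeries.derivative K)^[n] f)

/-- The generic series `∑_{m ≥ 1} X_m t^m / m!` over `K[X_1, X_2, …]`
(the variable `X_0` is never used). -/
def genericSeries (K : Type*) [Field K] : PowerSeries (MvPolynomial ℕ K) :=
  PowerSeries.mk fun m =>
    if m = 0 then 0 else MvPolynomial.C ((m.factorial : K)⁻¹) * MvPolynomial.X m

/-- The partial (exponential) Bell polynomials `B_{n,k}`, defined by their generating series
`(1/k!) (∑_{m ≥ 1} X_m t^m / m!)^k = ∑_n B_{n,k} t^n / n!`. -/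
def bellPoly (K : Type*) [Field K] (n k : ℕ) : MvPolynomial ℕ K :=
  MvPolynomial.C ((n.factorial : K) * (k.factorial : K)⁻¹) *
    PowerSeries.coeff n (genericSeries K ^ k)

/-- The ring `K[X_1, X_1⁻¹, X_2, X_3, …]` (polynomials that are Laurent in `X_1`). -/
abbrev LaurentRing (K : Type*) [Field K] : Type _ :=
  Localization.Away (MvPolynomial.X 1 : MvPolynomial ℕ K)

/-- `X_j` as an element of `LaurentRing K`. -/
def lvar (K : Type*) [Field K] (j : ℕ) : LaurentRing K :=
  algebraMap (MvPolynomial ℕ K) (LaurentRing K) (MvPolynomial.X j)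

/-- `X_1⁻¹` as an element of `LaurentRing K`. -/
def lvarInv (K : Type*) [Field K] : LaurentRing K :=
  IsLocalization.Away.invSelf (MvPolynomial.X 1 : MvPolynomial ℕ K)

/-- `B_{n,k}` as an element of `LaurentRing K`. -/
def lbell (K : Type*) [Field K] (n k : ℕ) : LaurentRing K :=
  algebraMap (MvPolynomial ℕ K) (LaurentRing K) (bellPoly K n k)

/-- The multivariate Stirling polynomials of the first kind `A_{n,k}`: the family determined
by `∑_{j=k}^n A_{n,j} B_{j,k} = δ_{n,k}`. As `B_{k,k} = X_1^k` is invertible, this relation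
is solved for `A_{n,k}` by downward recursion on `k` (see `stirlingA_ortho`). -/
def stirlingA (K : Type*) [Field K] (n k : ℕ) : LaurentRing K :=
  lvarInv K ^ k *
    ((if n = k then 1 else 0) -
      ∑ j : {j // j ∈ Finset.Ioc k n}, stirlingA K n j.1 * lbell K j.1 k)
termination_by n - k
decreasing_by
  have := Finset.mem_Ioc.mp j.2
  omega

/-- The multivariable Lah polynomials `L_{n,k} = ∑_{j=k}^n (-1)^j A_{n,j} B_{j,k}`. -/
def lahPoly (K : Type*) [Field K] (n k : ℕ) : LaurentRing K :=
  ∑ j ∈ Finset.Icc k n, (-1) ^ j * stirlingA K n j * lbell K j k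

/-- Substitution `X_j ↦ g_j` in a Laurent polynomial, for a sequence with `g_1 ≠ 0`
(the value `g 0` is irrelevant for all polynomials above). -/
def evalLaurent {K : Type*} [Field K] (g : ℕ → K) (hg : g 1 ≠ 0) : LaurentRing K →+* K :=
  IsLocalization.Away.lift (MvPolynomial.X 1 : MvPolynomial ℕ K) (g := MvPolynomial.eval g)
    (by simpa using hg)

/-- The subalgebra of Laurent polynomials which involve only the variables `X_1, …, X_m`:
it is generated by `X_1, …, X_m` and `X_1⁻¹` if `m ≥ 1`, and consists of the constants
if `m = 0`. -/
def laurentIn (K : Type*) [Field K] (m : ℕ) : Subalgebra K (LaurentRing K) :=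
  Algebra.adjoin K
    ({p | ∃ j, 1 ≤ j ∧ j ≤ m ∧ p = lvar K j} ∪ {p | 1 ≤ m ∧ p = lvarInv K})

theorem bellPoly_self (K : Type*) [Field K] [CharZero K] (k : ℕ) :
    bellPoly K k k = MvPolynomial.X 1 ^ k := by
  have h : genericSeries K = PowerSeries.X *
      PowerSeries.mk fun m => MvPolynomial.C (((m + 1).factorial : K)⁻¹) *
        (MvPolynomial.X (m + 1) : MvPolynomial ℕ K) := by
    ext1 n
    cases n with
    | zero => simp [genericSeries]
    | succ n => rw [PowerSeries.coeff_succ_X_mul]; simp [genericSeries]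
  have hk : (k.factorial : K) ≠ 0 := Nat.cast_ne_zero.mpr k.factorial_ne_zero
  have h2 := PowerSeries.coeff_X_pow_mul ((PowerSeries.mk fun m =>
    MvPolynomial.C (((m + 1).factorial : K)⁻¹) *
      (MvPolynomial.X (m + 1) : MvPolynomial ℕ K)) ^ k) k 0
  rw [zero_add] at h2
  rw [bellPoly, mul_inv_cancel₀ hk, h, mul_pow, h2]
  simp

theorem lvar_mul_lvarInv (K : Type*) [Field K] : lvar K 1 * lvarInv K = 1 :=
  IsLocalization.Away.mul_invSelf _

/-- The relation which determines the family `A_{n,k}`. -/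
theorem stirlingA_ortho (K : Type*) [Field K] [CharZero K] (n k : ℕ) (hk : k ≤ n) :
    ∑ j ∈ Finset.Icc k n, stirlingA K n j * lbell K j k = if n = k then 1 else 0 := by
  have hs : ∑ j : {j // j ∈ Finset.Ioc k n}, stirlingA K n j.1 * lbell K j.1 k =
      ∑ j ∈ Finset.Ioc k n, stirlingA K n j * lbell K j k :=
    Finset.sum_coe_sort (Finset.Ioc k n) fun j => stirlingA K n j * lbell K j k
  have hb : lbell K k k = lvar K 1 ^ k := by simp [lbell, lvar, bellPoly_self]
  have hu : lvar K 1 ^ k * lvarInv K ^ k = 1 := by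
    rw [← mul_pow, lvar_mul_lvarInv, one_pow]
  rw [← Finset.Ioc_insert_left hk, Finset.sum_insert (by simp), hb]
  rw [stirlingA, hs]
  linear_combination ((if n = k then 1 else 0) -
    ∑ j ∈ Finset.Ioc k n, stirlingA K n j * lbell K j k) * hu

end InvolutorySeries

end

/-! An involution `f ≠ X` satisfies `f₁ ^ 2 = 1`. If `f₁ = 1`, then `X + f` is invertible and fixed
by right composition with `f`, forcing `f = X`; hence `f₁ = -1`. Now `X - f` is invertible and `(X -
f) ∘ f = -(X - f)`, so its inverse `γ` satisfies `f ∘ γ = γ ∘ (-X)` (`exists_conj_neg`). Conversely,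
any conjugate of `-X` is an involution.

In Taylor coefficients, with `γ = ∑ g_m t^m / m!`, this equation reads `∑_k B_{j,k}(g) f_k = (-1)^j
B_{j,1}(g)`. Inverting the triangular Bell matrix by `A` gives `f_n = L_{n,1}(g)`
(`taylorCoeff_eq_evalLaurent_lahPoly`).

For the variables, adding the relation `∑ A_{n,j} B_{j,1} = 0` (`n ≥ 2`) to `L_{n,1}` cancels the
odd `j` and doubles the even ones; what survives has small enough indices. -/

open PowerSeries

namespace InvolutorySeries

/-! ### Variables occurring in the Bell, Stirling and Lah polynomials -/

section Variables

variable {K : Type*} [Field K]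

theorem lvar_mem_laurentIn {j m : ℕ} (h1 : 1 ≤ j) (h2 : j ≤ m) : lvar K j ∈ laurentIn K m :=
  Algebra.subset_adjoin (Or.inl ⟨j, h1, h2, rfl⟩)

theorem lvarInv_mem_laurentIn {m : ℕ} (h1 : 1 ≤ m) : lvarInv K ∈ laurentIn K m :=
  Algebra.subset_adjoin (Or.inr ⟨h1, rfl⟩)

theorem algebraMap_C_mem_laurentIn (c : K) (m : ℕ) :
    algebraMap (MvPolynomial ℕ K) (LaurentRing K) (MvPolynomial.C c) ∈ laurentIn K m := by
  rw [← MvPolynomial.algebraMap_eq, ← IsScalarTower.algebraMap_apply]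
  exact (laurentIn K m).algebraMap_mem c

theorem coeff_genericSeries_mem_laurentIn {n m : ℕ} (h : n ≤ m) :
    algebraMap (MvPolynomial ℕ K) (LaurentRing K) (coeff n (genericSeries K)) ∈
      laurentIn K m := by
  rw [genericSeries, coeff_mk]
  split_ifs with h0
  · rw [map_zero]
    exact zero_mem _
  · rw [map_mul]
    exact mul_mem (algebraMap_C_mem_laurentIn _ _)
      (lvar_mem_laurentIn (Nat.one_le_iff_ne_zero.mpr h0) h)

theorem constantCoeff_genericSeries : constantCoeff (genericSeries K) = 0 := by
  simp [genericSeries, ← coeff_zero_eq_constantCoeff_apply]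

theorem coeff_pow_eq_zero {R : Type*} [CommRing R] {γ : PowerSeries R}
    (hγ : constantCoeff γ = 0) {n k : ℕ} (h : n < k) : coeff n (γ ^ k) = 0 :=
  X_pow_dvd_iff.mp (pow_dvd_pow_of_dvd (X_dvd_iff.mpr hγ) k) n h

/-- The coefficient of `t ^ n` in the `k`-th power of the generic series involves only
`X_1, …, X_{n - k + 1}`. -/
theorem coeff_genericSeries_pow_mem_laurentIn (k : ℕ) :
    ∀ n m : ℕ, n < k + m →
      algebraMap (MvPolynomial ℕ K) (LaurentRing K) (coeff n (genericSeries K ^ k)) ∈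
        laurentIn K m := by
  induction k with
  | zero =>
    intro n m _
    rw [pow_zero, coeff_one]
    split_ifs
    · rw [map_one]
      exact one_mem _
    · rw [map_zero]
      exact zero_mem _
  | succ k ih =>
    intro n m h
    rw [pow_succ, coeff_mul, map_sum]
    refine sum_mem fun p hp => ?_
    have hp := Finset.HasAntidiagonal.mem_antidiagonal.mp hp
    rw [map_mul]
    -- A nonzero term has `p.1 ≥ k` and `p.2 ≥ 1`; with `p.1 + p.2 = n` this bounds both indices.
    rcases lt_or_ge p.1 k with h1 | h1
    · rw [coeff_pow_eq_zero constantCoeff_genericSeries h1, map_zero, zero_mul]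
      exact zero_mem _
    · rcases Nat.eq_zero_or_pos p.2 with h2 | h2
      · rw [h2, coeff_zero_eq_constantCoeff_apply, constantCoeff_genericSeries, map_zero,
          mul_zero]
        exact zero_mem _
      · exact mul_mem (ih _ _ (by omega)) (coeff_genericSeries_mem_laurentIn (by omega))

theorem lbell_mem_laurentIn {n k m : ℕ} (h : n < k + m) : lbell K n k ∈ laurentIn K m := by
  rw [lbell, bellPoly, map_mul]
  exact mul_mem (algebraMap_C_mem_laurentIn _ _)
    (coeff_genericSeries_pow_mem_laurentIn k n m h)

/-- The bound passes through the recursion, since `k < j ≤ n` gives both `n < j + m` and `j < k +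
m`. The factor `X_1⁻¹` is what requires `1 ≤ m`. -/
theorem stirlingA_mem_laurentIn (n k m : ℕ) (hm : 1 ≤ m) (h : n < k + m) :
    stirlingA K n k ∈ laurentIn K m := by
  rw [stirlingA]
  refine mul_mem (pow_mem (lvarInv_mem_laurentIn hm) k)
    (sub_mem ?_ (sum_mem fun j _ => ?_))
  · split_ifs
    · exact one_mem _
    · exact zero_mem _
  · have hj := Finset.mem_Ioc.mp j.2
    exact mul_mem (stirlingA_mem_laurentIn n j.1 m hm (by omega))
      (lbell_mem_laurentIn (by omega))
termination_by n - k

theorem lbell_one_right [CharZero K] {n : ℕ} (hn : 1 ≤ n) : lbell K n 1 = lvar K n := by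
  have h : (n.factorial : K) ≠ 0 := Nat.cast_ne_zero.mpr n.factorial_ne_zero
  rw [lbell, bellPoly, pow_one, genericSeries, coeff_mk, if_neg (by omega), ← mul_assoc,
    ← map_mul]
  simp [h, lvar]

theorem lahPoly_one_one [CharZero K] : lahPoly K 1 1 = -1 := by
  have h := stirlingA_ortho K 1 1 le_rfl
  simp only [Finset.Icc_self, Finset.sum_singleton, if_true] at h
  simp [lahPoly, h]

/-- The `A_{n,1}` term of `L_{n,1}` is eliminated by means of the defining relation. -/
theorem lahPoly_one_eq_sum_Ioc [CharZero K] {n : ℕ} (hn : 2 ≤ n) :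
    lahPoly K n 1 = ∑ j ∈ Finset.Ioc 1 n, (1 + (-1) ^ j) * (stirlingA K n j * lbell K j 1) := by
  have h := stirlingA_ortho K n 1 (by omega)
  rw [if_neg (by omega), ← Finset.Ioc_insert_left (by omega : 1 ≤ n),
    Finset.sum_insert (by simp)] at h
  rw [lahPoly, ← Finset.Ioc_insert_left (by omega : 1 ≤ n), Finset.sum_insert (by simp)]
  simp only [add_mul, one_mul, Finset.sum_add_distrib, mul_assoc] at h ⊢
  linear_combination -h

theorem lahPoly_one_mem_laurentIn [CharZero K] {n : ℕ} (hn : 1 ≤ n) :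
    lahPoly K n 1 ∈ laurentIn K (2 * (n / 2)) := by
  rcases hn.eq_or_lt with rfl | hn
  · rw [lahPoly_one_one]
    exact neg_mem (one_mem _)
  · rw [lahPoly_one_eq_sum_Ioc hn]
    refine sum_mem fun j hj => ?_
    have hj := Finset.mem_Ioc.mp hj
    rcases Nat.even_or_odd j with he | ho
    -- Evenness bounds the variable `X_j = B_{j,1}`; for `A_{n,j}`, `j ≥ 2` suffices, as `n - 1 ≤ 2
    -- * (n / 2)`.
    · have : j ≤ 2 * (n / 2) := by
        obtain ⟨i, rfl⟩ := he
        omega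
      refine mul_mem (add_mem (one_mem _) (pow_mem (neg_mem (one_mem _)) j))
        (mul_mem (stirlingA_mem_laurentIn n j _ (by omega) (by omega)) ?_)
      rw [lbell_one_right (by omega)]
      exact lvar_mem_laurentIn (by omega) this
    · rw [ho.neg_one_pow, add_neg_cancel, zero_mul]
      exact zero_mem _

end Variables

/-! ### Composition of series and evaluation of the polynomials -/

section Evaluation

variable {K : Type*} [Field K]

/-- The series `∑_{m ≥ 1} g_m t^m / m!`. -/
noncomputable def seriesOf (g : ℕ → K) : PowerSeries K :=
  PowerSeries.map (MvPolynomial.eval g) (genericSeries K)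

theorem constantCoeff_seriesOf (g : ℕ → K) : constantCoeff (seriesOf g) = 0 := by
  rw [seriesOf, ← coeff_zero_eq_constantCoeff_apply, coeff_map,
    coeff_zero_eq_constantCoeff_apply, constantCoeff_genericSeries, map_zero]

theorem coeff_seriesOf (g : ℕ → K) {n : ℕ} (hn : n ≠ 0) :
    coeff n (seriesOf g) = (n.factorial : K)⁻¹ * g n := by
  simp [seriesOf, genericSeries, hn]

theorem seriesOf_factorial_mul_coeff [CharZero K] {γ : PowerSeries K}
    (hγ : constantCoeff γ = 0) : seriesOf (fun n => (n.factorial : K) * coeff n γ) = γ := by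
  ext n
  rcases eq_or_ne n 0 with rfl | hn
  · rw [coeff_zero_eq_constantCoeff_apply, coeff_zero_eq_constantCoeff_apply,
      constantCoeff_seriesOf, hγ]
  · rw [coeff_seriesOf _ hn, inv_mul_cancel_left₀ (Nat.cast_ne_zero.mpr n.factorial_ne_zero)]

theorem evalLaurent_lbell (g : ℕ → K) (hg : g 1 ≠ 0) (n k : ℕ) :
    evalLaurent g hg (lbell K n k) =
      (n.factorial : K) * (k.factorial : K)⁻¹ * coeff n (seriesOf g ^ k) := by
  rw [evalLaurent, lbell, IsLocalization.Away.lift_eq, bellPoly, seriesOf, ← map_pow, coeff_map,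
    map_mul, MvPolynomial.eval_C]

theorem coeff_comp {γ : PowerSeries K} (hγ : constantCoeff γ = 0) (f : PowerSeries K) (n : ℕ) :
    coeff n (comp f γ) = ∑ k ∈ Finset.range (n + 1), coeff k f * coeff n (γ ^ k) := by
  rw [comp, coeff_subst' (HasSubst.of_constantCoeff_zero' hγ)]
  refine finsum_eq_sum_of_support_subset _ fun k hk => ?_
  rw [Finset.coe_range, Set.mem_Iio]
  by_contra h
  refine hk ?_
  dsimp only
  rw [coeff_pow_eq_zero hγ (by omega), smul_zero]

theorem constantCoeff_comp {f γ : PowerSeries K} (hf : constantCoeff f = 0)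
    (hγ : constantCoeff γ = 0) : constantCoeff (comp f γ) = 0 := by
  rw [← coeff_zero_eq_constantCoeff_apply, coeff_comp hγ]
  simp [hf]

theorem comp_assoc (f : PowerSeries K) {g h : PowerSeries K} (hg : constantCoeff g = 0)
    (hh : constantCoeff h = 0) : comp (comp f g) h = comp f (comp g h) :=
  subst_comp_subst_apply (HasSubst.of_constantCoeff_zero' hg)
    (HasSubst.of_constantCoeff_zero' hh) f

theorem comp_X (f : PowerSeries K) : comp f X = f := X_subst f

theorem X_comp {h : PowerSeries K} (hh : constantCoeff h = 0) : comp X h = h :=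
  subst_X (HasSubst.of_constantCoeff_zero' hh)

theorem neg_comp (f : PowerSeries K) {h : PowerSeries K} (hh : constantCoeff h = 0) :
    comp (-f) h = -comp f h := by
  rw [comp, comp, ← coe_substAlgHom (HasSubst.of_constantCoeff_zero' hh), map_neg]

theorem coeff_comp_neg_X (f : PowerSeries K) (n : ℕ) :
    coeff n (comp f (-X)) = (-1) ^ n * coeff n f := by
  rw [comp, ← neg_one_smul K (X : PowerSeries K), ← rescale_eq_subst, coeff_rescale]

theorem exists_comp_inverse {h : PowerSeries K} (h1 : coeff 1 h ≠ 0)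
    (h0 : constantCoeff h = 0) :
    ∃ γ : PowerSeries K, constantCoeff γ = 0 ∧ coeff 1 γ ≠ 0 ∧
      comp γ h = X ∧ comp h γ = X := by
  have hu : IsUnit (coeff 1 h) := h1.isUnit
  refine ⟨substInvOfIsUnit h hu, constantCoeff_substInvOfIsUnit h hu, ?_,
    subst_substInvOfIsUnit_left h h0 hu, subst_substInvOfIsUnit_right h h0 hu⟩
  rw [coeff_one_substInvOfIsUnit]
  exact Units.ne_zero _

theorem taylorCoeff_eq (f : PowerSeries K) (n : ℕ) :
    taylorCoeff f n = (n.factorial : K) * coeff n f := by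
  rw [taylorCoeff, constantCoeff_iterate_derivative]

/-- If `f ∘ γ = γ ∘ (-id)` for `γ = ∑_{m ≥ 1} g_m t^m / m!`, then `f_n = L_{n,1}(g)`. -/
theorem taylorCoeff_eq_evalLaurent_lahPoly [CharZero K] {f : PowerSeries K}
    (hf : constantCoeff f = 0) (g : ℕ → K) (hg : g 1 ≠ 0)
    (h : comp f (seriesOf g) = comp (seriesOf g) (-X)) {n : ℕ} (hn : 1 ≤ n) :
    taylorCoeff f n = evalLaurent g hg (lahPoly K n 1) := by
  set γ := seriesOf g with hγ
  have hsub : ∀ j ∈ Finset.Icc 1 n, (-1) ^ j * evalLaurent g hg (lbell K j 1) =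
      ∑ k ∈ Finset.Icc 1 n, evalLaurent g hg (lbell K j k) * taylorCoeff f k := by
    intro j hj
    have hj := Finset.mem_Icc.mp hj
    have hc := congrArg (coeff j) h
    rw [coeff_comp (constantCoeff_seriesOf g), coeff_comp_neg_X] at hc
    -- A range of `k` independent of `j` allows the later exchange of sums; the terms with `k = 0`
    -- or `k > j` vanish.
    have hs : ∑ k ∈ Finset.range (j + 1), coeff k f * coeff j (γ ^ k) =
        ∑ k ∈ Finset.Icc 1 n, coeff k f * coeff j (γ ^ k) := by
      rw [Finset.range_eq_Ico, Finset.sum_eq_sum_Ico_succ_bot (by omega),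
        coeff_zero_eq_constantCoeff_apply, hf, zero_mul, zero_add]
      refine Finset.sum_subset (fun k hk => ?_) fun k hk hk' => ?_
      · rw [Finset.mem_Ico] at hk
        rw [Finset.mem_Icc]
        omega
      · rw [Finset.mem_Ico] at hk'
        rw [Finset.mem_Icc] at hk
        rw [coeff_pow_eq_zero (constantCoeff_seriesOf g) (by omega), mul_zero]
    rw [hs] at hc
    rw [evalLaurent_lbell, pow_one, ← hγ, Nat.factorial_one, Nat.cast_one, inv_one, mul_one,
      mul_left_comm, ← hc, Finset.mul_sum]
    refine Finset.sum_congr rfl fun k _ => ?_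
    rw [evalLaurent_lbell, taylorCoeff_eq, ← hγ]
    have : (k.factorial : K) ≠ 0 := Nat.cast_ne_zero.mpr k.factorial_ne_zero
    field_simp
  have hA : ∀ k ∈ Finset.Icc 1 n, ∑ j ∈ Finset.Icc 1 n,
      evalLaurent g hg (stirlingA K n j) * evalLaurent g hg (lbell K j k) =
        if n = k then 1 else 0 := by
    intro k hk
    have hk := Finset.mem_Icc.mp hk
    have := congrArg (evalLaurent g hg) (stirlingA_ortho K n k hk.2)
    rw [map_sum] at this
    simp only [map_mul, apply_ite (evalLaurent g hg), map_one, map_zero] at this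
    rw [← this]
    symm
    refine Finset.sum_subset (Finset.Icc_subset_Icc_left hk.1) fun j hj hj' => ?_
    rw [Finset.mem_Icc] at hj hj'
    rw [evalLaurent_lbell, coeff_pow_eq_zero (constantCoeff_seriesOf g) (by omega), mul_zero,
      mul_zero]
  rw [lahPoly, map_sum]
  calc taylorCoeff f n
      = ∑ k ∈ Finset.Icc 1 n, (if n = k then 1 else 0) * taylorCoeff f k := by
        simp [Finset.sum_ite_eq, hn]
    _ = ∑ k ∈ Finset.Icc 1 n, ∑ j ∈ Finset.Icc 1 n, evalLaurent g hg (stirlingA K n j) *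
          (evalLaurent g hg (lbell K j k) * taylorCoeff f k) := by
        refine Finset.sum_congr rfl fun k hk => ?_
        rw [← hA k hk, Finset.sum_mul]
        exact Finset.sum_congr rfl fun j _ => mul_assoc _ _ _
    _ = ∑ j ∈ Finset.Icc 1 n, evalLaurent g hg (stirlingA K n j) *
          ∑ k ∈ Finset.Icc 1 n, evalLaurent g hg (lbell K j k) * taylorCoeff f k := by
        rw [Finset.sum_comm]
        simp only [Finset.mul_sum]
    _ = _ := by
        refine Finset.sum_congr rfl fun j hj => ?_
        rw [← hsub j hj, map_mul, map_mul, map_pow, map_neg, map_one]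
        ring

end Evaluation

/-! ### Involutions as conjugates of `-X` -/

section Conjugation

variable {K : Type*} [Field K]

theorem comp_inj_right {f f' γ δ : PowerSeries K} (hγ : constantCoeff γ = 0)
    (hδ : constantCoeff δ = 0) (h : comp γ δ = X) (hff : comp f γ = comp f' γ) : f = f' := by
  rw [← comp_X f, ← comp_X f', ← h, ← comp_assoc f hγ hδ, hff, comp_assoc f' hγ hδ]

/-- A series of the form `γ ∘ (-id) ∘ γ⁻¹` is an involution. -/
theorem comp_self_of_conj_neg {f γ δ : PowerSeries K} (hf : constantCoeff f = 0)
    (hγ : constantCoeff γ = 0) (hδ : constantCoeff δ = 0) (hγδ : comp γ δ = X)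
    (h : comp f γ = comp γ (-X)) : comp f f = X := by
  have hX : constantCoeff (-X : PowerSeries K) = 0 := by simp
  refine comp_inj_right hγ hδ hγδ ?_
  rw [comp_assoc f hf hγ, h, ← comp_assoc f hγ hX, h, comp_assoc γ hX hX, neg_comp X hX,
    X_comp hX, neg_neg, comp_X, X_comp hγ]

theorem coeff_one_comp {f γ : PowerSeries K} (hγ : constantCoeff γ = 0) :
    coeff 1 (comp f γ) = coeff 1 f * coeff 1 γ := by
  rw [coeff_comp hγ]
  simp [Finset.sum_range_succ, coeff_one]

/-- An involution other than the identity is tangent to `-id`. -/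
theorem coeff_one_of_comp_self [CharZero K] {f : PowerSeries K} (hf : constantCoeff f = 0)
    (hff : comp f f = X) (hne : f ≠ X) : coeff 1 f = -1 := by
  have h1 : coeff 1 f * coeff 1 f = 1 := by rw [← coeff_one_comp hf, hff, coeff_one_X]
  refine (mul_self_eq_one_iff.mp h1).resolve_left fun h => hne ?_
  have h0 : constantCoeff (X + f) = 0 := by simp [hf]
  obtain ⟨γ, hγ, -, hγh, -⟩ := exists_comp_inverse (h := X + f)
    (by rw [map_add, coeff_one_X, h]; norm_num) h0
  have hinv : comp (X + f) f = X + f := by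
    rw [comp, subst_add (HasSubst.of_constantCoeff_zero' hf)]
    change comp X f + comp f f = _
    rw [X_comp hf, hff, add_comm]
  rw [← X_comp hf, ← hγh, comp_assoc γ h0 hf, hinv]

/-- An involution other than the identity is conjugate to `-id`. -/
theorem exists_conj_neg [CharZero K] {f : PowerSeries K} (hf : constantCoeff f = 0)
    (hff : comp f f = X) (hne : f ≠ X) :
    ∃ γ : PowerSeries K, constantCoeff γ = 0 ∧ coeff 1 γ ≠ 0 ∧ comp f γ = comp γ (-X) := by
  have h0 : constantCoeff (X - f) = 0 := by simp [hf]
  obtain ⟨γ, hγ, hγ1, hγh, hhγ⟩ := exists_comp_inverse (h := X - f)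
    (by rw [map_sub, coeff_one_X, coeff_one_of_comp_self hf hff hne]; norm_num) h0
  refine ⟨γ, hγ, hγ1, ?_⟩
  have hinv : comp (X - f) f = -(X - f) := by
    rw [comp, subst_sub (HasSubst.of_constantCoeff_zero' hf)]
    change comp X f - comp f f = _
    rw [X_comp hf, hff, neg_sub]
  have hfγ : comp f γ = comp γ (comp (comp (X - f) f) γ) := by
    rw [comp_assoc _ hf hγ, ← comp_assoc γ h0 (constantCoeff_comp hf hγ), hγh,
      X_comp (constantCoeff_comp hf hγ)]
  rw [hfγ, hinv, neg_comp _ hγ, hhγ]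

end Conjugation

end InvolutorySeries

open InvolutorySeries in
theorem mainTheorem2 {K : Type*} [Field K] [CharZero K] (f : PowerSeries K)
    (hf : InvolutorySeries.IsInvertible f) (hne : f ≠ PowerSeries.X) :
    (∀ n : ℕ, 1 ≤ n →
      InvolutorySeries.lahPoly K n 1 ∈ InvolutorySeries.laurentIn K (2 * (n / 2))) ∧
    (InvolutorySeries.IsInvolutory f ↔
      ∃ (g : ℕ → K) (hg : g 1 ≠ 0), ∀ n : ℕ, 1 ≤ n →
        InvolutorySeries.taylorCoeff f n =
          InvolutorySeries.evalLaurent g hg (InvolutorySeries.lahPoly K n 1)) := by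
  refine ⟨fun n hn => lahPoly_one_mem_laurentIn hn, ?_, ?_⟩
  · rintro ⟨-, hff⟩
    obtain ⟨γ, hγ, hγ1, h⟩ := exists_conj_neg hf.1 hff hne
    refine ⟨fun n => (n.factorial : K) * coeff n γ, by simpa using hγ1, fun n hn =>
      taylorCoeff_eq_evalLaurent_lahPoly hf.1 _ _ ?_ hn⟩
    rw [seriesOf_factorial_mul_coeff hγ, h]
  · rintro ⟨g, hg, h⟩
    have hγ := constantCoeff_seriesOf g
    obtain ⟨δ, hδ, -, hδγ, hγδ⟩ := exists_comp_inverse (h := seriesOf g)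
      (by rw [coeff_seriesOf g one_ne_zero]; simpa using hg) hγ
    have hX : constantCoeff (-X : PowerSeries K) = 0 := by simp
    have hnδ := constantCoeff_comp hX hδ
    have hφ : constantCoeff (comp (seriesOf g) (comp (-X) δ)) = 0 :=
      constantCoeff_comp hγ hnδ
    have hφγ : comp (comp (seriesOf g) (comp (-X) δ)) (seriesOf g) =
        comp (seriesOf g) (-X) := by
      rw [comp_assoc _ hnδ hγ, comp_assoc _ hδ hγ, hδγ, comp_X]
    -- The conjugate of `-X` by `seriesOf g` has the same Taylor coefficients `L_{n,1}(g)` as `f`.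
    have hfφ : f = comp (seriesOf g) (comp (-X) δ) := by
      ext n
      rcases Nat.eq_zero_or_pos n with rfl | hn
      · rw [coeff_zero_eq_constantCoeff_apply, coeff_zero_eq_constantCoeff_apply, hf.1, hφ]
      · have := (h n hn).trans (taylorCoeff_eq_evalLaurent_lahPoly hφ g hg hφγ hn).symm
        rw [taylorCoeff_eq, taylorCoeff_eq] at this
        exact mul_left_cancel₀ (Nat.cast_ne_zero.mpr n.factorial_ne_zero) this
    exact ⟨hf, comp_self_of_conj_neg hf.1 hγ hδ hγδ (by rw [hfφ, hφγ])⟩
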